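/- A pair $(G,\alpha)$ consists of a compact (Hausdorff) group $G$ and an automorphism $\alpha$ of the topological group $G$. It is *topologically transitive* if there is $x\in G$ whose orbit $\{\alpha^n(x)\mid n\in\mathbb Z\}$ is dense in $G$, and it has *finite depth* if there is an open subgroup $V\leq G$ with $\bigcap_{k\in\mathbb Z}\alpha^k(V)=\{1\}$. A subgroup $H\le G$ is *$\alpha$-stable* if $\alpha(H)=H$; a closed $\alpha$-stable subgroup $H$ is called topologically transitive if $(H,\alpha|_H)$ is. Two pairs $(G_1,\alpha_1)$ and $(G_2,\alpha_2)$ are *co-commensurable* if there are a pair $(K,\gamma)$ and continuous surjective homomorphisms $\varphi_i:K\to G_i$ with $\varphi_i\circ\gamma=\alpha_i\circ\varphi_i$ and $\ker\varphi_i$ finite, for $i=1,2$. A *subnormal series* for $(G,\alpha)$ is a finite sequence $$\{1\}=G_0\leq G_1\leq\cdots\leq G_r=G$$ of closed, $\alpha$-stable, topologically transitive subgroups of $G$ such that, for each $j\in\{1,\dots,r\}$, $G_{j-1}$ is normal in $G_j$ and the automorphism $\alpha_j$ induced by $\alpha$ on $G_j/G_{j-1}$ is topologically transitive. The pairs $(G_j/G_{j-1},\alpha_j)$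 are its *subquotients*. A *refinement* of a subnormal series is a subnormal series obtained from it by inserting finitely many (possibly no) further terms. Two subnormal series $(G_j)_{0\le j\le r}$ and $(H_j)_{0\le j\le s}$ for $(G,\alpha)$ are *equivalent* if $r=s$ and there is a permutation $\pi$ of $\{1,\dots,r\}$ such that, for each $j$, the $j$th subquotient of the first series is co-commensurable with the $\pi(j)$th subquotient of the second. **Theorem.** Let $(G,\alpha)$ be a topologically transitive pair with finite depth. Then any two subnormal series for $(G,\alpha)$ have equivalent refinements. -/

import Mathlib

namespace FiniteDepth

universe u

section Pairs

variable {G : Type u} [Group G] [TopologicalSpace G]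

/-- The integer iterate `α ^ k` of the automorphism `α` of the topological group `G`; the power is
taken in the group of automorphisms of `G`. -/
def iter (α : G ≃ₜ* G) (k : ℤ) : MulAut G :=
  (α.toMulEquiv : MulAut G) ^ k

/-- The pair `(G, α)` is topologically transitive: some two-sided orbit `{α ^ n (x) | n ∈ ℤ}` is
dense in `G`. -/
def TopTransitive (α : G ≃ₜ* G) : Prop :=
  ∃ x : G, Dense (Set.range fun n : ℤ => iter α n x)

/-- The pair `(G, α)` has finite depth: there is an open subgroup `V` of `G` such that the
intersection of all `α ^ k (V)`, `k ∈ ℤ`, is trivial. -/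
def HasFiniteDepth (α : G ≃ₜ* G) : Prop :=
  ∃ V : Subgroup G, IsOpen (V : Set G) ∧ ⨅ k : ℤ, V.map (iter α k).toMonoidHom = ⊥

/-- The subgroup `H` is `α`-stable: `α (H) = H`. -/
def Stable (α : G ≃ₜ* G) (H : Subgroup G) : Prop :=
  H.map α.toMulEquiv.toMonoidHom = H

theorem Stable.apply_mem {α : G ≃ₜ* G} {H : Subgroup G} (h : Stable α H) {x : G} (hx : x ∈ H) :
    α x ∈ H := by
  have h' : H.map α.toMulEquiv.toMonoidHom = H := h
  rw [← h']
  exact ⟨x, hx, rfl⟩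

theorem Stable.symm_apply_mem {α : G ≃ₜ* G} {H : Subgroup G} (h : Stable α H) {x : G}
    (hx : x ∈ H) : α.symm x ∈ H := by
  have h' : H.map α.toMulEquiv.toMonoidHom = H := h
  rw [← h'] at hx
  obtain ⟨y, hy, rfl⟩ := hx
  have : α.symm (α y) = y := α.symm_apply_apply y
  exact this.symm ▸ hy

/-- The restriction of `α` to the `α`-stable subgroup `H`, which has the subspace topology. -/
def restrict (α : G ≃ₜ* G) (H : Subgroup G) (h : Stable α H) : H ≃ₜ* H where
  toFun x := ⟨α x, h.apply_mem x.2⟩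
  invFun x := ⟨α.symm x, h.symm_apply_mem x.2⟩
  left_inv x := Subtype.ext (α.symm_apply_apply (x : G))
  right_inv x := Subtype.ext (α.apply_symm_apply (x : G))
  map_mul' x y := Subtype.ext (map_mul α (x : G) (y : G))
  continuous_toFun := (α.continuous_toFun.comp continuous_subtype_val).subtype_mk _
  continuous_invFun := (α.continuous_invFun.comp continuous_subtype_val).subtype_mk _

/-- The automorphism `x N ↦ α (x) N` induced by `α` on the quotient of `G` by the `α`-stable normal
subgroup `N`; the quotient has the quotient topology. -/
def onQuotient (α : G ≃ₜ* G) (N : Subgroup G) [N.Normal] (h : Stable α N) :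
    (G ⧸ N) ≃ₜ* (G ⧸ N) where
  toMulEquiv := QuotientGroup.congr N N α.toMulEquiv h
  continuous_toFun := continuous_quot_lift _ (continuous_quot_mk.comp α.continuous_toFun)
  continuous_invFun := continuous_quot_lift _ (continuous_quot_mk.comp α.continuous_invFun)

theorem Stable.subgroupOf {α : G ≃ₜ* G} {K H : Subgroup G} (hK : Stable α K) (hH : Stable α H) :
    Stable (restrict α H hH) (K.subgroupOf H) := by
  ext x
  constructor
  · rintro ⟨y, hy, rfl⟩
    exact hK.apply_mem hy
  · intro hx
    exact ⟨⟨α.symm x, hH.symm_apply_mem x.2⟩, hK.symm_apply_mem hx,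
      Subtype.ext (α.apply_symm_apply (x : G))⟩

/-- For `α`-stable subgroups `K` and `H` with `K ∩ H` normal in `H`, the automorphism that `α`
induces on `H / (K ∩ H)`. It is used when `K ≤ H`, so that this quotient is `H / K`. -/
def onSubquotient (α : G ≃ₜ* G) (K H : Subgroup G) (hK : Stable α K) (hH : Stable α H)
    [(K.subgroupOf H).Normal] : (H ⧸ K.subgroupOf H) ≃ₜ* (H ⧸ K.subgroupOf H) :=
  onQuotient (restrict α H hH) (K.subgroupOf H) (hK.subgroupOf hH)

end Pairs

/-- The pairs `(G₁, α₁)` and `(G₂, α₂)` are co-commensurable: there are a pair `(K, γ)`, that is, a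
compact (Hausdorff) group `K` with a (topological) automorphism `γ`, and continuous surjective
homomorphisms `φ₁ : K → G₁` and `φ₂ : K → G₂` that have finite kernels and intertwine the
automorphisms. -/
def CoCommensurable {G₁ G₂ : Type u} [Group G₁] [TopologicalSpace G₁]
    [Group G₂] [TopologicalSpace G₂] (α₁ : G₁ ≃ₜ* G₁) (α₂ : G₂ ≃ₜ* G₂) : Prop :=
  ∃ (K : Type u) (_ : Group K) (_ : TopologicalSpace K) (_ : IsTopologicalGroup K)
    (_ : CompactSpace K) (_ : T2Space K) (γ : K ≃ₜ* K) (φ₁ : K →ₜ* G₁) (φ₂ : K →ₜ* G₂),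
    Function.Surjective φ₁ ∧ Function.Surjective φ₂ ∧
    (∀ x, φ₁ (γ x) = α₁ (φ₁ x)) ∧ (∀ x, φ₂ (γ x) = α₂ (φ₂ x)) ∧
    (φ₁.toMonoidHom.ker : Set K).Finite ∧ (φ₂.toMonoidHom.ker : Set K).Finite

/-- A subnormal series `{1} = G₀ ◁ G₁ ◁ ⋯ ◁ Gᵣ = G` for the pair `(G, α)`: all the terms are
closed, `α`-stable and topologically transitive, each is normal in the next one, and `α` induces a
topologically transitive automorphism on each subquotient. Repetitions are allowed. -/
structure SubnormalSeries {G : Type u} [Group G] [TopologicalSpace G] (α : G ≃ₜ* G) where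
  /-- The length `r` of the series. -/
  length : ℕ
  /-- The terms `G₀, …, Gᵣ` of the series. -/
  term : Fin (length + 1) → Subgroup G
  term_zero : term 0 = ⊥
  term_last : term (Fin.last length) = ⊤
  isClosed : ∀ i, IsClosed (term i : Set G)
  stable : ∀ i, Stable α (term i)
  transitive : ∀ i, TopTransitive (restrict α (term i) (stable i))
  le : ∀ j : Fin length, term j.castSucc ≤ term j.succ
  normal : ∀ j : Fin length, ((term j.castSucc).subgroupOf (term j.succ)).Normal
  transitive_quotient : ∀ j : Fin length,
    haveI := normal j
    TopTransitive (onSubquotient α (term j.castSucc) (term j.succ) (stable _) (stable _))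

namespace SubnormalSeries

variable {G : Type u} [Group G] [TopologicalSpace G] {α : G ≃ₜ* G}

/-- The underlying group `G_{j+1} / G_j` of a subquotient of the series (`j = 0, …, r - 1`). -/
abbrev Subquotient (S : SubnormalSeries α) (j : Fin S.length) : Type u :=
  S.term j.succ ⧸ (S.term j.castSucc).subgroupOf (S.term j.succ)

instance (S : SubnormalSeries α) (j : Fin S.length) :
    ((S.term j.castSucc).subgroupOf (S.term j.succ)).Normal :=
  S.normal j

/-- The automorphism that `α` induces on a subquotient of the series. -/
def subquotientAut (S : SubnormalSeries α) (j : Fin S.length) :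
    S.Subquotient j ≃ₜ* S.Subquotient j :=
  onSubquotient α (S.term j.castSucc) (S.term j.succ) (S.stable _) (S.stable _)

/-- Two subnormal series are equivalent: there is a bijection between their index sets under which
corresponding subquotients are co-commensurable. (Such a bijection forces the lengths to be equal,
and is then a permutation of the indices.) -/
def Equivalent (S T : SubnormalSeries α) : Prop :=
  ∃ π : Fin S.length ≃ Fin T.length,
    ∀ j : Fin S.length, CoCommensurable (S.subquotientAut j) (T.subquotientAut (π j))

/-- `T` is a refinement of `S`: the subnormal series `T` is obtained from `S` by inserting finitely
many (possibly no) further terms. -/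
def IsRefinement (T S : SubnormalSeries α) : Prop :=
  ∃ f : Fin (S.length + 1) → Fin (T.length + 1), StrictMono f ∧ ∀ i, T.term (f i) = S.term i

end SubnormalSeries

end FiniteDepth

namespace FiniteDepth

open Filter Topology

universe u

/-! ### Iterates and stable subgroups. -/

section Iterates

variable {G : Type u} [Group G] [TopologicalSpace G] (α : G ≃ₜ* G)

/-! The proof is Schreier refinement with a Zassenhaus butterfly that holds only up to finite index.
The intersection of two transitive subgroups need not be transitive, so each intersection `A` is
replaced by its nub, the closure of the contraction group inside `A`.

What makes this work is `HasFiniteDepth.isOpen_closure_con`: at finite depth the closure of the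
contraction group is open. Hence transitivity means that the contraction group is dense
(`HasFiniteDepth.topTransitive_iff`), closed stable transitive subgroups are those equal to their
nub, and the nub of a closed stable subgroup has finite index in it (`relIndex_nub_ne_zero`).

For series `a` and `b`, put `X = nub (a (i+1) ⊓ b (j+1))` and `Y = nub (a (i+1) ⊓ b j) ⊔ nub (a i ⊓
b (j+1))`. The quotient `X / Y` maps onto both corresponding Schreier subquotients with finite
kernels (`isFiniteCover`), which is co-commensurability. -/

theorem iter_zero (x : G) : iter α 0 x = x := by
  simp [iter]

theorem iter_one (x : G) : iter α 1 x = α x := by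
  rw [iter, zpow_one]
  rfl

theorem iter_add (j k : ℤ) (x : G) : iter α (j + k) x = iter α j (iter α k x) := by
  simp [iter, zpow_add]

theorem iter_neg_apply_iter (k : ℤ) (x : G) : iter α (-k) (iter α k x) = x := by
  rw [← iter_add, neg_add_cancel, iter_zero]

theorem iter_apply_iter_neg (k : ℤ) (x : G) : iter α k (iter α (-k) x) = x := by
  rw [← iter_add, add_neg_cancel, iter_zero]

theorem iter_symm (k : ℤ) : iter α.symm k = iter α (-k) := by
  have h : (α.symm.toMulEquiv : MulAut G) = (α.toMulEquiv : MulAut G)⁻¹ := rfl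
  rw [iter, iter, h, inv_zpow']

theorem iter_add_one (k : ℤ) (x : G) : iter α (k + 1) x = α (iter α k x) := by
  rw [add_comm, iter_add, iter_one]

theorem iter_neg_one (x : G) : iter α (-1) x = α.symm x := by
  rw [← iter_symm, iter_one]

theorem continuous_iter (k : ℤ) : Continuous (iter α k) := by
  induction k using Int.induction_on with
  | zero => exact continuous_id.congr fun x => (iter_zero α x).symm
  | succ n ih =>
    exact (α.continuous_toFun.comp ih).congr fun x => (iter_add_one α _ x).symm
  | pred n ih =>
    refine (α.continuous_invFun.comp ih).congr fun x => ?_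
    rw [sub_eq_neg_add, iter_add, iter_neg_one]
    rfl

theorem coe_iter_restrict {H : Subgroup G} (h : Stable α H) (k : ℤ) (x : H) :
    (iter (restrict α H h) k x : G) = iter α k x := by
  induction k using Int.induction_on generalizing x with
  | zero => simp [iter_zero]
  | succ n ih => rw [iter_add_one, iter_add_one, ← ih]; rfl
  | pred n ih =>
    rw [sub_eq_neg_add, iter_add, iter_add, ← ih, iter_neg_one, iter_neg_one]; rfl

variable {α}

theorem stable_of_mem {H : Subgroup G} (h₁ : ∀ x ∈ H, α x ∈ H) (h₂ : ∀ x ∈ H, α.symm x ∈ H) :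
    Stable α H := by
  refine le_antisymm ?_ fun x hx => ⟨α.symm x, h₂ x hx, α.apply_symm_apply x⟩
  rintro _ ⟨x, hx, rfl⟩
  exact h₁ x hx

theorem Stable.symm {H : Subgroup G} (h : Stable α H) : Stable α.symm H :=
  stable_of_mem (fun _ => h.symm_apply_mem) fun _ => h.apply_mem

theorem Stable.iter_mem {H : Subgroup G} (h : Stable α H) (k : ℤ) {x : G} (hx : x ∈ H) :
    iter α k x ∈ H := by
  rw [← coe_iter_restrict α h k ⟨x, hx⟩]
  exact Subtype.prop _

theorem Stable.iter_mem_iff {H : Subgroup G} (h : Stable α H) (k : ℤ) {x : G} :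
    iter α k x ∈ H ↔ x ∈ H :=
  ⟨fun hx => iter_neg_apply_iter α k x ▸ h.iter_mem (-k) hx, h.iter_mem k⟩

theorem Stable.inf {H K : Subgroup G} (hH : Stable α H) (hK : Stable α K) : Stable α (H ⊓ K) :=
  stable_of_mem (fun _ hx => ⟨hH.apply_mem hx.1, hK.apply_mem hx.2⟩)
    fun _ hx => ⟨hH.symm_apply_mem hx.1, hK.symm_apply_mem hx.2⟩

theorem Stable.sup {H K : Subgroup G} (hH : Stable α H) (hK : Stable α K) : Stable α (H ⊔ K) := by
  unfold Stable at *
  rw [Subgroup.map_sup, hH, hK]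

theorem Stable.topologicalClosure [IsTopologicalGroup G] {H : Subgroup G} (h : Stable α H) :
    Stable α H.topologicalClosure :=
  stable_of_mem
    (fun _ hx => map_mem_closure α.continuous_toFun hx fun _ => h.apply_mem)
    fun _ hx => map_mem_closure α.continuous_invFun hx fun _ => h.symm_apply_mem

end Iterates

/-! ### The contraction group. -/

section Contraction

variable {G : Type u} [Group G] [TopologicalSpace G] [IsTopologicalGroup G] (α : G ≃ₜ* G)

/-- The contraction group of `α`: the elements `x` with `α ^ k (x) → 1` as `k → ∞`. -/
def con : Subgroup G where
  carrier := {x | Tendsto (fun k : ℕ => iter α k x) atTop (𝓝 1)}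
  one_mem' := by simpa using tendsto_const_nhds
  mul_mem' := by
    intro x y hx hy
    simpa using Tendsto.mul hx hy
  inv_mem' := by
    intro x hx
    simpa using Tendsto.inv hx

variable {α}

theorem mem_con {x : G} : x ∈ con α ↔ Tendsto (fun k : ℕ => iter α k x) atTop (𝓝 1) :=
  Iff.rfl

theorem iter_mem_con (j : ℤ) {x : G} (hx : x ∈ con α) : iter α j x ∈ con α := by
  have h := ((continuous_iter α j).tendsto 1).comp (mem_con.1 hx)
  rw [map_one] at h
  refine h.congr fun k => ?_
  simp only [Function.comp_apply]
  rw [← iter_add, ← iter_add, add_comm]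

theorem stable_con : Stable α (con α) :=
  stable_of_mem (fun x hx => iter_one α x ▸ iter_mem_con 1 hx)
    fun x hx => iter_neg_one α x ▸ iter_mem_con (-1) hx

/-- A forward orbit tending to 1 enters `U`, and stability pulls its starting point back into `U`.
-/
theorem con_le_of_isOpen {U : Subgroup G} (hU : IsOpen (U : Set G)) (hs : Stable α U) :
    con α ≤ U := by
  intro x hx
  obtain ⟨k, hk⟩ := ((mem_con.1 hx).eventually (hU.mem_nhds U.one_mem)).exists
  exact (hs.iter_mem_iff _).1 hk

theorem mem_con_restrict {H : Subgroup G} (h : Stable α H) {x : H} :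
    x ∈ con (restrict α H h) ↔ (x : G) ∈ con α := by
  rw [mem_con, mem_con, tendsto_subtype_rng]
  simp only [coe_iter_restrict, Subgroup.coe_one]

end Contraction

/-! ### Cylinder subgroups: constraints on the orbit over a set of times. -/

section Cylinders

variable {G : Type u} [Group G] [TopologicalSpace G] (α : G ≃ₜ* G) (V : Subgroup G)

/-- The elements `x` such that `α ^ k (x) ∈ V` for all `k ∈ s`. -/
def cyl (s : Set ℤ) : Subgroup G :=
  ⨅ k ∈ s, V.comap (iter α k).toMonoidHom

variable {α V}

theorem mem_cyl {s : Set ℤ} {x : G} : x ∈ cyl α V s ↔ ∀ k ∈ s, iter α k x ∈ V := by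
  simp [cyl, Subgroup.mem_iInf]

theorem cyl_anti {s t : Set ℤ} (h : s ⊆ t) : cyl α V t ≤ cyl α V s :=
  fun _ hx => mem_cyl.2 fun k hk => mem_cyl.1 hx k (h hk)

instance cyl_normal [hV : V.Normal] (s : Set ℤ) : (cyl α V s).Normal :=
  ⟨fun x hx g => mem_cyl.2 fun k hk => by
    simpa using hV.conj_mem _ (mem_cyl.1 hx k hk) (iter α k g)⟩

theorem isClosed_cyl (hV : IsClosed (V : Set G)) (s : Set ℤ) :
    IsClosed (cyl α V s : Set G) := by
  have : (cyl α V s : Set G) = ⋂ k ∈ s, iter α k ⁻¹' (V : Set G) := by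
    ext x
    simp [mem_cyl]
  rw [this]
  exact isClosed_biInter fun k _ => hV.preimage (continuous_iter α k)

theorem isOpen_cyl (hV : IsOpen (V : Set G)) {s : Set ℤ} (hs : s.Finite) :
    IsOpen (cyl α V s : Set G) := by
  have : (cyl α V s : Set G) = ⋂ k ∈ s, iter α k ⁻¹' (V : Set G) := by
    ext x
    simp [mem_cyl]
  rw [this]
  exact hs.isOpen_biInter fun k _ => hV.preimage (continuous_iter α k)

theorem comap_iter_cyl (j a b : ℤ) :
    (cyl α V (Set.Icc a b)).comap (iter α j).toMonoidHom = cyl α V (Set.Icc (a + j) (b + j)) := by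
  ext x
  simp only [Subgroup.mem_comap, mem_cyl, Set.mem_Icc]
  constructor
  · intro h k hk
    have := h (k - j) (by lia)
    have e : iter α (k - j) ((iter α j).toMonoidHom x) = iter α k x := by
      change iter α (k - j) (iter α j x) = _
      rw [← iter_add, sub_add_cancel]
    rwa [e] at this
  · intro h k hk
    change iter α k (iter α j x) ∈ V
    rw [← iter_add]
    exact h _ (by lia)

end Cylinders

/-! ### Finite index and compactness arguments. -/

section CompactGroups

variable {G : Type u} [Group G] [TopologicalSpace G] [IsTopologicalGroup G] [CompactSpace G]

theorem index_ne_zero_of_isOpen {U : Subgroup G} (hU : IsOpen (U : Set G)) : U.index ≠ 0 := by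
  have := U.quotient_finite_of_isOpen hU
  exact Subgroup.index_ne_zero_of_finite

theorem eq_of_le_of_index_eq {H : Type*} [Group H] {A B : Subgroup H} (hAB : A ≤ B)
    (hA : A.index ≠ 0) (h : A.index = B.index) : A = B := by
  refine le_antisymm hAB (Subgroup.relIndex_eq_one.1 ?_)
  have := Subgroup.relIndex_mul_index hAB
  rw [h] at this hA
  exact Nat.eq_of_mul_eq_mul_right (Nat.pos_of_ne_zero hA) (by simpa using this)

/-- An antitone sequence of subgroups containing a subgroup of finite index stabilises. -/
theorem exists_forall_eq_of_antitone {H : Type*} [Group H] {A : ℕ → Subgroup H} (hA : Antitone A)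
    {B : Subgroup H} (hB : B.index ≠ 0) (hBA : ∀ n, B ≤ A n) : ∃ n, ∀ m, n ≤ m → A m = A n := by
  have hne : ∀ n, (A n).index ≠ 0 := fun n h0 =>
    hB (Nat.eq_zero_of_zero_dvd (h0 ▸ Subgroup.index_dvd_of_le (hBA n)))
  have hbdd : ∀ n, (A n).index ≤ B.index := fun n =>
    Nat.le_of_dvd (Nat.pos_of_ne_zero hB) (Subgroup.index_dvd_of_le (hBA n))
  have hfin : (Set.range fun n => (A n).index).Finite :=
    (Set.finite_Iic B.index).subset (by rintro _ ⟨n, rfl⟩; exact hbdd n)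
  obtain ⟨_, ⟨n, rfl⟩, hn⟩ := hfin.exists_maximal (Set.range_nonempty _)
  refine ⟨n, fun m hm => eq_of_le_of_index_eq (hA hm) (hne m) ?_⟩
  have hle : (A n).index ≤ (A m).index :=
    Nat.le_of_dvd (Nat.pos_of_ne_zero (hne m)) (Subgroup.index_dvd_of_le (hA hm))
  exact le_antisymm (hn ⟨m, rfl⟩ hle) hle

/-- The possible left factors of `x` form nested nonempty compact sets, so one factor serves all
`n`: the product with `B` commutes with the intersection. -/
theorem iInf_sup_le_sup [T2Space G] {A : ℕ → Subgroup G} [∀ n, (A n).Normal] (hA : Antitone A)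
    (hAc : ∀ n, IsClosed (A n : Set G)) {B : Subgroup G} (hB : IsClosed (B : Set G)) {x : G}
    (hx : ∀ n, x ∈ A n ⊔ B) : ∃ y, (∀ n, y ∈ A n) ∧ ∃ z ∈ B, y * z = x := by
  have hcl : ∀ n, IsClosed {y : G | y ∈ A n ∧ y⁻¹ * x ∈ B} := fun n =>
    (hAc n).inter (hB.preimage (by fun_prop : Continuous fun y : G => y⁻¹ * x))
  obtain ⟨y, hy⟩ := IsCompact.nonempty_iInter_of_sequence_nonempty_isCompact_isClosed
    (fun n => {y : G | y ∈ A n ∧ y⁻¹ * x ∈ B})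
    (fun n y hy => ⟨hA n.le_succ hy.1, hy.2⟩)
    (fun n => by
      obtain ⟨y, hy, z, hz, rfl⟩ := Subgroup.mem_sup_of_normal_left.1 (hx n)
      exact ⟨y, hy, by simpa using hz⟩)
    (hcl 0).isCompact hcl
  rw [Set.mem_iInter] at hy
  exact ⟨y, fun n => (hy n).1, y⁻¹ * x, (hy 0).2, mul_inv_cancel_left y x⟩

end CompactGroups

/-! ### Finite depth: transitivity is density of the contraction group. -/

section FiniteDepthGroups

variable {G : Type u} [Group G] [TopologicalSpace G] {α : G ≃ₜ* G}

theorem hasFiniteDepth_iff :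
    HasFiniteDepth α ↔
      ∃ V : Subgroup G, IsOpen (V : Set G) ∧ ∀ x, (∀ k, iter α k x ∈ V) → x = 1 := by
  have key : ∀ (V : Subgroup G) (x : G),
      x ∈ ⨅ k : ℤ, V.map (iter α k).toMonoidHom ↔ ∀ k, iter α k x ∈ V := by
    intro V x
    rw [Subgroup.mem_iInf]
    constructor
    · intro h k
      obtain ⟨y, hy, hyx⟩ := h (-k)
      have : iter α k x = y := by
        rw [← hyx]
        exact iter_apply_iter_neg α k y
      rwa [this]
    · intro h k
      exact ⟨iter α (-k) x, h (-k), iter_apply_iter_neg α k x⟩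
  refine exists_congr fun V => and_congr_right fun _ => ?_
  rw [Subgroup.eq_bot_iff_forall]
  simp only [key]

theorem HasFiniteDepth.symm (h : HasFiniteDepth α) : HasFiniteDepth α.symm := by
  obtain ⟨V, hV, hsep⟩ := hasFiniteDepth_iff.1 h
  refine hasFiniteDepth_iff.2 ⟨V, hV, fun x hx => hsep x fun k => ?_⟩
  simpa [iter_symm] using hx (-k)

theorem HasFiniteDepth.restrict (h : HasFiniteDepth α) {H : Subgroup G} (hs : Stable α H) :
    HasFiniteDepth (restrict α H hs) := by
  obtain ⟨V, hV, hsep⟩ := hasFiniteDepth_iff.1 h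
  refine hasFiniteDepth_iff.2 ⟨V.subgroupOf H, hV.preimage continuous_subtype_val, fun x hx => ?_⟩
  refine Subtype.ext (hsep x fun k => ?_)
  rw [← coe_iter_restrict α hs]
  exact hx k

theorem TopTransitive.eq_top_of_isClopen (h : TopTransitive α) {U : Subgroup G}
    (hU : IsOpen (U : Set G)) (hUc : IsClosed (U : Set G)) (hs : Stable α U) : U = ⊤ := by
  obtain ⟨x, hx⟩ := h
  obtain ⟨_, hkU, k, rfl⟩ := hx.inter_open_nonempty _ hU ⟨1, U.one_mem⟩
  have hxU : x ∈ U := (hs.iter_mem_iff k).1 hkU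
  have hr : (Set.range fun n : ℤ => iter α n x) ⊆ U := by
    rintro _ ⟨n, rfl⟩
    exact hs.iter_mem n hxU
  rw [← Subgroup.coe_eq_univ, ← hUc.closure_eq]
  exact (hx.mono hr).closure_eq

variable {V : Subgroup G}

/-- The cylinders are nested compact sets with intersection 1, so by compactness they enter every
neighbourhood of 1. -/
theorem exists_cyl_subset [CompactSpace G] (hV : IsClosed (V : Set G))
    (hsep : ∀ x, (∀ k, iter α k x ∈ V) → x = 1) {U : Set G} (hU : U ∈ 𝓝 (1 : G)) :
    ∃ m : ℕ, (cyl α V (Set.Icc (-m : ℤ) m) : Set G) ⊆ U := by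
  have hanti : Antitone fun m : ℕ => (cyl α V (Set.Icc (-m : ℤ) m) : Set G) :=
    fun m n hmn => cyl_anti (Set.Icc_subset_Icc (by lia) (by lia))
  refine exists_subset_nhds_of_isCompact' hanti.directed_ge
    (fun m => (isClosed_cyl hV _).isCompact) (fun m => isClosed_cyl hV _) fun x hx => ?_
  rw [Set.mem_iInter] at hx
  have : x = 1 := hsep x fun k =>
    mem_cyl.1 (hx k.natAbs) k (by simp only [Set.mem_Icc]; lia)
  rwa [this]

variable [IsTopologicalGroup G] [CompactSpace G]

/-- The open subgroup witnessing finite depth may be taken normal. -/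
theorem HasFiniteDepth.exists_normal (h : HasFiniteDepth α) :
    ∃ V : Subgroup G, V.Normal ∧ IsOpen (V : Set G) ∧ ∀ x, (∀ k, iter α k x ∈ V) → x = 1 := by
  obtain ⟨V, hV, hsep⟩ := hasFiniteDepth_iff.1 h
  have : V.FiniteIndex := ⟨index_ne_zero_of_isOpen hV⟩
  refine ⟨V.normalCore, inferInstance, ?_, fun x hx => hsep x fun k => V.normalCore_le (hx k)⟩
  exact V.normalCore.isOpen_of_isClosed_of_finiteIndex
    (V.normalCore_isClosed (V.isClosed_of_isOpen hV))

/-- If the orbit stays in `V` from time `a` on, its late points satisfy the constraint on any window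
`[-m, m]`. -/
theorem cyl_Ici_le_con (hV : IsClosed (V : Set G))
    (hsep : ∀ x, (∀ k, iter α k x ∈ V) → x = 1) (a : ℤ) : cyl α V (Set.Ici a) ≤ con α := by
  intro x hx
  refine mem_con.2 fun U hU => ?_
  obtain ⟨m, hm⟩ := exists_cyl_subset hV hsep hU
  refine mem_map.2 (mem_atTop_sets.2 ⟨a.natAbs + m, fun k hk => hm (mem_cyl.2 fun j hj => ?_)⟩)
  rw [← iter_add]
  refine mem_cyl.1 hx _ ?_
  simp only [Set.mem_Icc, Set.mem_Ici] at hj ⊢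
  lia

variable [T2Space G]

/-- The products of the `[1, n]` cylinders with `V` stabilise. By compactness `x = y * z` with `y`
constrained at all times `≥ 1`, hence contracted, and `z ∈ V`. If `x` is constrained on `[1, n]`, so
is `z`, which thus gains time 0. -/
theorem exists_cyl_le_closure_con_sup [V.Normal] (hV : IsOpen (V : Set G))
    (hsep : ∀ x, (∀ k, iter α k x ∈ V) → x = 1) :
    ∃ n₀ : ℕ, ∀ n, n₀ ≤ n →
      cyl α V (Set.Icc 1 (n : ℤ)) ≤ cyl α V (Set.Icc 0 (n : ℤ)) ⊔ (con α).topologicalClosure := by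
  have hVc := V.isClosed_of_isOpen hV
  have hanti : Antitone fun n : ℕ => cyl α V (Set.Icc 1 (n : ℤ)) :=
    fun m n hmn => cyl_anti (Set.Icc_subset_Icc le_rfl (by lia))
  obtain ⟨n₀, hn₀⟩ := exists_forall_eq_of_antitone
    (A := fun n : ℕ => cyl α V (Set.Icc 1 (n : ℤ)) ⊔ V)
    (fun m n hmn => sup_le_sup_right (hanti hmn) V) (index_ne_zero_of_isOpen hV)
    fun n => le_sup_right
  refine ⟨n₀, fun n hn x hx => ?_⟩
  obtain ⟨y, hy, z, hz, rfl⟩ := iInf_sup_le_sup hanti (fun n => isClosed_cyl hVc _) hVc (x := x)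
    (fun m => by
      rcases le_total m n with hmn | hmn
      · exact Subgroup.mem_sup_left (hanti hmn hx)
      · have : cyl α V (Set.Icc 1 (m : ℤ)) ⊔ V = cyl α V (Set.Icc 1 (n : ℤ)) ⊔ V :=
          (hn₀ m (hn.trans hmn)).trans (hn₀ n hn).symm
        rw [this]
        exact Subgroup.mem_sup_left hx)
  refine mul_mem (Subgroup.mem_sup_right (Subgroup.le_topologicalClosure _
    (cyl_Ici_le_con hVc hsep 1 (mem_cyl.2 fun k hk => ?_)))) (Subgroup.mem_sup_left ?_)
  · refine mem_cyl.1 (hy k.natAbs) k ?_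
    simp only [Set.mem_Icc, Set.mem_Ici] at hk ⊢
    lia
  · have hz' : z ∈ cyl α V (Set.Icc 1 (n : ℤ)) := by
      simpa using mul_mem (inv_mem (hy n)) hx
    refine mem_cyl.2 fun k hk => ?_
    rcases eq_or_ne k 0 with rfl | h0
    · rwa [iter_zero]
    · refine mem_cyl.1 hz' k ?_
      simp only [Set.mem_Icc] at hk ⊢
      lia

/-- In a pair of finite depth the closure of the contraction group is open. -/
theorem HasFiniteDepth.isOpen_closure_con (h : HasFiniteDepth α) :
    IsOpen ((con α).topologicalClosure : Set G) := by
  obtain ⟨V, _, hV, hsep⟩ := h.exists_normal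
  have hVc := V.isClosed_of_isOpen hV
  set L := (con α).topologicalClosure with hL
  have hLs : Stable α L := stable_con.topologicalClosure
  -- Since `L` is stable, the index depends only on the length of the window.
  have hshift : ∀ a b j : ℤ, (cyl α V (Set.Icc (a + j) (b + j)) ⊔ L).index =
      (cyl α V (Set.Icc a b) ⊔ L).index := by
    intro a b j
    have hs : Function.Surjective (iter α j).toMonoidHom := (iter α j).surjective
    rw [← Subgroup.index_comap_of_surjective (cyl α V (Set.Icc a b) ⊔ L) hs,
      ← Subgroup.comap_sup_eq _ _ _ hs, comap_iter_cyl]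
    congr 2
    ext x
    exact (hLs.iter_mem_iff j).symm
  obtain ⟨n₀, hn₀⟩ := exists_cyl_le_closure_con_sup hV hsep
  -- Modulo `L` the constraint at time 0 is free, so `[0, n + 1]` may be replaced by `[1, n + 1]`, a
  -- translate of `[0, n]`.
  have hconst : ∀ n : ℕ, n₀ ≤ n → (cyl α V (Set.Icc 0 (n : ℤ)) ⊔ L).index =
      (cyl α V (Set.Icc 0 (n₀ : ℤ)) ⊔ L).index := by
    intro n hn
    induction n, hn using Nat.le_induction with
    | base => rfl
    | succ n hn ih =>
      rw [← ih, ← hshift 0 n 1]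
      congr 1
      refine le_antisymm (sup_le_sup_right (cyl_anti (Set.Icc_subset_Icc (by lia) (by lia))) _) ?_
      have := hn₀ (n + 1) (by lia)
      push_cast at this ⊢
      exact sup_le this le_sup_right
  have hanti : Antitone fun m : ℕ => cyl α V (Set.Icc (-m : ℤ) m) :=
    fun m n hmn => cyl_anti (Set.Icc_subset_Icc (by lia) (by lia))
  -- One side contains the other, and `[-k, k]` is a translate of `[0, 2k]`, so the finite indices
  -- agree.
  have heq : ∀ k : ℕ, n₀ ≤ k → cyl α V (Set.Icc (-k : ℤ) k) ⊔ L =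
      cyl α V (Set.Icc 0 (n₀ : ℤ)) ⊔ L := by
    intro k hk
    refine eq_of_le_of_index_eq
      (sup_le_sup_right (cyl_anti (Set.Icc_subset_Icc (by lia) (by lia))) _) ?_ ?_
    · exact index_ne_zero_of_isOpen
        (Subgroup.isOpen_mono le_sup_left (isOpen_cyl hV (Set.finite_Icc _ _)))
    · rw [← hconst (2 * k) (by lia), ← hshift 0 _ (-k)]
      congr 4 <;> push_cast <;> ring
  -- Intersecting over `k` leaves only `L`, because the two-sided cylinders shrink to 1.
  have hle : cyl α V (Set.Icc 0 (n₀ : ℤ)) ≤ L := by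
    intro x hx
    obtain ⟨y, hy, z, hz, rfl⟩ := iInf_sup_le_sup hanti (fun n => isClosed_cyl hVc _)
      (con α).isClosed_topologicalClosure (x := x) fun m => by
        have h1 : x ∈ cyl α V (Set.Icc (-(max m n₀ : ℕ) : ℤ) (max m n₀ : ℕ)) ⊔ L := by
          rw [heq _ (le_max_right _ _)]
          exact Subgroup.mem_sup_left hx
        exact sup_le_sup_right (hanti (le_max_left m n₀)) L h1
    have : y = 1 := hsep y fun k =>
      mem_cyl.1 (hy k.natAbs) k (by simp only [Set.mem_Icc]; lia)
    rwa [this, one_mul]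
  exact Subgroup.isOpen_mono hle (isOpen_cyl hV (Set.finite_Icc _ _))

/-- The closure of `con α.symm` is open and stable, so it contains `con α`. -/
theorem HasFiniteDepth.dense_con_symm (h : HasFiniteDepth α) (hd : Dense (con α : Set G)) :
    Dense (con α.symm : Set G) := by
  have hs : Stable α (con α.symm).topologicalClosure :=
    (stable_con (α := α.symm)).topologicalClosure.symm
  have hle : (con α : Set G) ⊆ (con α.symm).topologicalClosure :=
    con_le_of_isOpen h.symm.isOpen_closure_con hs
  have hd' := hd.mono hle
  rw [Subgroup.topologicalClosure_coe] at hd'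
  exact dense_closure.1 hd'

/-- A pair of finite depth with dense contraction group is topologically transitive. -/
theorem HasFiniteDepth.topTransitive_of_dense_con (h : HasFiniteDepth α)
    (hd : Dense (con α : Set G)) : TopTransitive α := by
  obtain ⟨V, _, hV, hsep⟩ := h.exists_normal
  have hVc := V.isClosed_of_isOpen hV
  have hd' := h.dense_con_symm hd
  let W : ℕ → Subgroup G := fun m => cyl α V (Set.Icc (-m : ℤ) m)
  have hWo : ∀ m, IsOpen (W m : Set G) := fun m => isOpen_cyl hV (Set.finite_Icc _ _)
  have hWn : ∀ m, (W m).Normal := fun m => cyl_normal _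
  have hfin : ∀ m, Finite (G ⧸ W m) := fun m => (W m).quotient_finite_of_isOpen (hWo m)
  -- Baire category: `O p` collects the points whose orbit meets the coset `p`. There are countably
  -- many cosets, as each quotient is finite.
  let O : (Σ m, G ⧸ W m) → Set G := fun p =>
    ⋃ k : ℤ, iter α k ⁻¹' ((QuotientGroup.mk : G → G ⧸ W p.1) ⁻¹' {p.2})
  have hcoset : ∀ m (g : G), (QuotientGroup.mk : G → G ⧸ W m) ⁻¹' {(g : G ⧸ W m)} =
      {x | g⁻¹ * x ∈ W m} := by
    intro m g
    ext x
    rw [Set.mem_preimage, Set.mem_singleton_iff, eq_comm, QuotientGroup.eq]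
    rfl
  have hcosetOpen : ∀ m (g : G), IsOpen {x : G | g⁻¹ * x ∈ W m} := fun m g =>
    (hWo m).preimage (continuous_const_mul g⁻¹)
  have hOo : ∀ p, IsOpen (O p) := by
    rintro ⟨m, q⟩
    obtain ⟨g, rfl⟩ := QuotientGroup.mk_surjective q
    refine isOpen_iUnion fun k => IsOpen.preimage (continuous_iter α k) ?_
    rw [hcoset]
    exact hcosetOpen m g
  have hOd : ∀ p, Dense (O p) := by
    rintro ⟨m, q⟩
    obtain ⟨g, rfl⟩ := QuotientGroup.mk_surjective q
    refine dense_iff_inter_open.2 fun U hU hne => ?_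
    obtain ⟨a, haU, ha⟩ := hd.inter_open_nonempty U hU hne
    obtain ⟨b, hbU, hb⟩ := hd'.inter_open_nonempty _ (hcosetOpen m g) ⟨g, by simp [one_mem]⟩
    -- The point `a * α⁻ᵏ(b)` is near `a`, while its image `αᵏ(a) * b` under `αᵏ` is near `b`.
    have h1 : Tendsto (fun k : ℕ => a * iter α.symm k b) atTop (𝓝 a) := by
      simpa using tendsto_const_nhds.mul (mem_con.1 hb)
    have h2 := (mem_con.1 ha).eventually ((hWo m).mem_nhds (one_mem _))
    obtain ⟨k, hk1, hk2⟩ := ((h1.eventually (hU.mem_nhds haU)).and h2).exists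
    refine ⟨_, hk1, Set.mem_iUnion.2 ⟨k, ?_⟩⟩
    rw [hcoset]
    have e : iter α k (a * iter α.symm k b) = iter α k a * b := by
      rw [map_mul, iter_symm, iter_apply_iter_neg]
    change g⁻¹ * iter α k (a * iter α.symm k b) ∈ W m
    rw [e, show g⁻¹ * (iter α k a * b) = (g⁻¹ * iter α k a * g) * (g⁻¹ * b) by group]
    exact mul_mem ((hWn m).conj_mem' _ hk2 g) hbU
  obtain ⟨x, hx⟩ := (dense_iInter_of_isOpen hOo hOd).nonempty
  refine ⟨x, dense_iff_inter_open.2 fun U hU ⟨u, hu⟩ => ?_⟩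
  have hnhds : (fun y => u * y) ⁻¹' U ∈ 𝓝 (1 : G) :=
    (hU.preimage (continuous_const_mul u)).mem_nhds (by simpa using hu)
  obtain ⟨m, hm⟩ := exists_cyl_subset hVc hsep hnhds
  obtain ⟨k, hk⟩ := Set.mem_iUnion.1 (Set.mem_iInter.1 hx ⟨m, (u : G ⧸ W m)⟩)
  rw [hcoset] at hk
  refine ⟨iter α k x, ?_, k, rfl⟩
  have := hm hk
  simpa using this

/-- A pair of finite depth is topologically transitive iff its contraction group is dense. -/
theorem HasFiniteDepth.topTransitive_iff (h : HasFiniteDepth α) :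
    TopTransitive α ↔ Dense (con α : Set G) := by
  refine ⟨fun ht => ?_, h.topTransitive_of_dense_con⟩
  have := ht.eq_top_of_isClopen h.isOpen_closure_con (con α).isClosed_topologicalClosure
    stable_con.topologicalClosure
  rw [dense_iff_closure_eq, ← Subgroup.topologicalClosure_coe, this, Subgroup.coe_top]

end FiniteDepthGroups

/-! ### Transitivity passes to quotients. -/

section Equivariant

variable {G H : Type*} [Group G] [TopologicalSpace G] [Group H] [TopologicalSpace H]
  {α : G ≃ₜ* G} {β : H ≃ₜ* H}

theorem map_iter_of_equivariant {f : G → H} (hf : ∀ x, f (α x) = β (f x)) (k : ℤ) (x : G) :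
    f (iter α k x) = iter β k (f x) := by
  induction k using Int.induction_on generalizing x with
  | zero => simp [iter_zero]
  | succ n ih => rw [iter_add_one, iter_add_one, hf, ih]
  | pred n ih =>
    have hsymm : ∀ y, f (α.symm y) = β.symm (f y) := fun y => by
      rw [eq_comm, ContinuousMulEquiv.symm_apply_eq, ← hf, α.apply_symm_apply]
    rw [sub_eq_neg_add, iter_add, iter_add, iter_neg_one, iter_neg_one, hsymm, ih]

theorem TopTransitive.of_surjective (h : TopTransitive α) {f : G → H} (hc : Continuous f)
    (hs : Function.Surjective f) (hf : ∀ x, f (α x) = β (f x)) : TopTransitive β := by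
  obtain ⟨x, hx⟩ := h
  refine ⟨f x, ?_⟩
  have := hs.denseRange.dense_image hc hx
  rw [← Set.range_comp] at this
  simpa only [Function.comp_def, map_iter_of_equivariant hf] using this

theorem TopTransitive.onSubquotient {K H : Subgroup G} {hH : Stable α H}
    (h : TopTransitive (restrict α H hH)) (hK : Stable α K) [(K.subgroupOf H).Normal] :
    TopTransitive (onSubquotient α K H hK hH) :=
  h.of_surjective continuous_quot_mk (QuotientGroup.mk_surjective (s := K.subgroupOf H))
    fun _ => rfl

end Equivariant

/-! ### Nubs. -/

section Nub

variable {G : Type u} [Group G] [TopologicalSpace G] [IsTopologicalGroup G] (α : G ≃ₜ* G)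

/-- The nub of `α` on a subgroup `A`: the closure of the contraction group of `α` in `A`. -/
def nub (A : Subgroup G) : Subgroup G :=
  (con α ⊓ A).topologicalClosure

variable {α} {A B : Subgroup G}

theorem isClosed_nub : IsClosed (nub α A : Set G) :=
  Subgroup.isClosed_topologicalClosure _

theorem nub_mono (h : A ≤ B) : nub α A ≤ nub α B :=
  Subgroup.topologicalClosure_mono (inf_le_inf_left _ h)

theorem nub_le (hA : IsClosed (A : Set G)) : nub α A ≤ A :=
  Subgroup.topologicalClosure_minimal _ inf_le_right hA

theorem stable_nub (hA : Stable α A) : Stable α (nub α A) :=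
  (stable_con.inf hA).topologicalClosure

theorem nub_nub : nub α (nub α A) = nub α A :=
  le_antisymm (nub_le isClosed_nub)
    (Subgroup.topologicalClosure_mono (le_inf inf_le_left (Subgroup.le_topologicalClosure _)))

theorem nub_bot [T2Space G] : nub α ⊥ = ⊥ :=
  le_bot_iff.1 (nub_le (by simp))

/-- Conjugation by `con α ⊓ B` preserves `con α ⊓ A`; joint continuity extends this to both
closures. -/
theorem nub_le_normalizer_nub (h : B ≤ Subgroup.normalizer A) :
    nub α B ≤ Subgroup.normalizer (nub α A) := by
  rw [Subgroup.le_normalizer_iff] at h ⊢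
  intro g hg x hx
  refine map_mem_closure₂ (f := fun g x : G => g * x * g⁻¹) (by fun_prop) hg hx ?_
  rintro g ⟨hg₁, hg₂⟩ x ⟨hx₁, hx₂⟩
  exact ⟨(con α).mul_mem ((con α).mul_mem hg₁ hx₁) ((con α).inv_mem hg₁), h g hg₂ x hx₂⟩

/-- The product of two topologically transitive subgroups, one normalising the other, is
topologically transitive. -/
theorem nub_sup_eq (hA : nub α A = A) (hB : nub α B = B)
    (hc : IsClosed ((A ⊔ B : Subgroup G) : Set G)) : nub α (A ⊔ B) = A ⊔ B :=
  le_antisymm (nub_le hc)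
    (sup_le (hA.ge.trans (nub_mono le_sup_left)) (hB.ge.trans (nub_mono le_sup_right)))

variable [CompactSpace G] [T2Space G]

/-- Finite depth restricts to `A`, so the closed contraction group of the restriction is open in the
compact group `A`. -/
theorem relIndex_nub_ne_zero (h : HasFiniteDepth α) (hA : IsClosed (A : Set G))
    (hs : Stable α A) : (nub α A).relIndex A ≠ 0 := by
  have : CompactSpace A := isCompact_iff_compactSpace.1 hA.isCompact
  have h' := h.restrict hs
  have hle : (con (restrict α A hs)).topologicalClosure ≤ (nub α A).subgroupOf A := by
    refine Subgroup.topologicalClosure_minimal _ (fun x hx => ?_)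
      (isClosed_nub.preimage continuous_subtype_val)
    exact Subgroup.le_topologicalClosure _ ⟨(mem_con_restrict hs).1 hx, x.2⟩
  intro h0
  exact index_ne_zero_of_isOpen h'.isOpen_closure_con
    (Nat.eq_zero_of_zero_dvd (h0 ▸ Subgroup.index_dvd_of_le hle))

/-- A closed stable subgroup is topologically transitive iff it equals its nub. -/
theorem topTransitive_restrict_iff (h : HasFiniteDepth α) (hA : IsClosed (A : Set G))
    (hs : Stable α A) : TopTransitive (restrict α A hs) ↔ nub α A = A := by
  have : CompactSpace A := isCompact_iff_compactSpace.1 hA.isCompact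
  have himage : Subtype.val '' (con (restrict α A hs) : Set A) = (con α ⊓ A : Subgroup G) := by
    ext x
    constructor
    · rintro ⟨y, hy, rfl⟩
      exact ⟨(mem_con_restrict hs).1 hy, y.2⟩
    · rintro ⟨hx, hxA⟩
      exact ⟨⟨x, hxA⟩, (mem_con_restrict hs).2 hx, rfl⟩
  rw [(h.restrict hs).topTransitive_iff, Subtype.dense_iff]
  change (A : Set G) ⊆ closure (Subtype.val '' (con (restrict α A hs) : Set A)) ↔ _
  rw [himage]
  exact ⟨fun hle => le_antisymm (nub_le hA) hle, fun heq => heq.ge⟩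

theorem isClosed_sup_of_le_normalizer (hA : IsClosed (A : Set G))
    (hB : IsClosed (B : Set G)) (h : A ≤ Subgroup.normalizer B) :
    IsClosed ((A ⊔ B : Subgroup G) : Set G) := by
  rw [Subgroup.coe_mul_of_left_le_normalizer_right _ _ h]
  exact (hA.isCompact.mul hB.isCompact).isClosed

end Nub

/-! ### Finite covers between subquotients. -/

section Covers

variable {G : Type u} [Group G]

/-- Conditions under which the inclusion `X ≤ D` induces a surjective homomorphism with finite
kernel from `X / Y` to `D / D'`. -/
structure IsFiniteCover (X Y D D' : Subgroup G) : Prop where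
  le : X ≤ D
  le' : Y ≤ D'
  exists_mul : ∀ d ∈ D, ∃ x ∈ X, ∃ d' ∈ D', x * d' = d
  exists_finite : ∃ Z ≤ X, Y.relIndex Z ≠ 0 ∧ ∀ x ∈ X, x ∈ D' → ∃ y ∈ Y, ∃ z ∈ Z, y * z = x

variable [TopologicalSpace G] {α : G ≃ₜ* G} {X Y D D' : Subgroup G}

theorem IsFiniteCover.exists_hom (h : IsFiniteCover X Y D D') (hYX : Y ≤ X)
    (hX : Stable α X) (hY : Stable α Y) (hD : Stable α D) (hD' : Stable α D')
    [(Y.subgroupOf X).Normal] [(D'.subgroupOf D).Normal] :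
    ∃ φ : (X ⧸ Y.subgroupOf X) →ₜ* (D ⧸ D'.subgroupOf D), Function.Surjective φ ∧
      (∀ x, φ (onSubquotient α Y X hY hX x) = onSubquotient α D' D hD' hD (φ x)) ∧
      (φ.toMonoidHom.ker : Set (X ⧸ Y.subgroupOf X)).Finite := by
  have hcomap : Y.subgroupOf X ≤ (D'.subgroupOf D).comap (Subgroup.inclusion h.le) :=
    fun x hx => h.le' hx
  let φ : (X ⧸ Y.subgroupOf X) →ₜ* (D ⧸ D'.subgroupOf D) :=
    { QuotientGroup.map _ _ (Subgroup.inclusion h.le) hcomap with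
      continuous_toFun := continuous_quot_lift _
        (continuous_quot_mk.comp (continuous_subtype_val.subtype_mk _)) }
  have hφ : ∀ x : X, φ (x : X ⧸ Y.subgroupOf X) =
      (Subgroup.inclusion h.le x : D ⧸ D'.subgroupOf D) := fun _ => rfl
  refine ⟨φ, fun q => ?_, fun q => ?_, ?_⟩
  · obtain ⟨⟨d, hd⟩, rfl⟩ := QuotientGroup.mk_surjective q
    obtain ⟨x, hx, d', hd', rfl⟩ := h.exists_mul d hd
    refine ⟨((⟨x, hx⟩ : X) : X ⧸ Y.subgroupOf X), ?_⟩
    rw [hφ, QuotientGroup.eq]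
    change x⁻¹ * (x * d') ∈ D'
    rwa [inv_mul_cancel_left]
  · obtain ⟨x, rfl⟩ := QuotientGroup.mk_surjective q
    rfl
  -- The kernel lies in the image of `Z`, which is finite because `Y` meets `Z` in finite index.
  · obtain ⟨Z, hZX, hYZ, hmem⟩ := h.exists_finite
    let ψ : Z →* X ⧸ Y.subgroupOf X :=
      (QuotientGroup.mk' (Y.subgroupOf X)).comp (Subgroup.inclusion hZX)
    have hle : Y.subgroupOf Z ≤ ψ.ker := fun z hz =>
      (QuotientGroup.eq_one_iff (Subgroup.inclusion hZX z)).2 hz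
    have hidx : ψ.ker.index ≠ 0 := fun h0 =>
      hYZ (Nat.eq_zero_of_zero_dvd (h0 ▸ Subgroup.index_dvd_of_le hle))
    rw [Subgroup.index_ker] at hidx
    have hfin : (ψ.range : Set (X ⧸ Y.subgroupOf X)).Finite := Nat.finite_of_card_ne_zero hidx
    refine hfin.subset fun q hq => ?_
    obtain ⟨x, rfl⟩ := QuotientGroup.mk_surjective q
    have hxD' : (x : G) ∈ D' :=
      (QuotientGroup.eq_one_iff (N := D'.subgroupOf D) (Subgroup.inclusion h.le x)).1 hq
    obtain ⟨y, hy, z, hz, hyz⟩ := hmem x x.2 hxD'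
    refine ⟨⟨z, hz⟩, ?_⟩
    change ((Subgroup.inclusion hZX ⟨z, hz⟩ : X) : X ⧸ Y.subgroupOf X) = x
    have hn : (Y.subgroupOf X).Normal := inferInstance
    rw [QuotientGroup.eq]
    have := hn.conj_mem' ⟨y, hYX hy⟩ hy ⟨z, hZX hz⟩
    rw [Subgroup.mem_subgroupOf] at this ⊢
    simpa [← hyz, mul_assoc] using this

/-- `X / Y` is the common cover; it is compact since `X` is closed and Hausdorff since `Y` is. -/
theorem IsFiniteCover.coCommensurable [IsTopologicalGroup G] [CompactSpace G]
    {D₁ D₁' D₂ D₂' : Subgroup G} (h₁ : IsFiniteCover X Y D₁ D₁') (h₂ : IsFiniteCover X Y D₂ D₂')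
    (hYX : Y ≤ X) (hYn : X ≤ Subgroup.normalizer Y) (hXc : IsClosed (X : Set G))
    (hYc : IsClosed (Y : Set G)) (hX : Stable α X) (hY : Stable α Y)
    (hD₁ : Stable α D₁) (hD₁' : Stable α D₁') (hD₂ : Stable α D₂) (hD₂' : Stable α D₂')
    [(D₁'.subgroupOf D₁).Normal] [(D₂'.subgroupOf D₂).Normal] :
    CoCommensurable (onSubquotient α D₁' D₁ hD₁' hD₁) (onSubquotient α D₂' D₂ hD₂' hD₂) := by
  have : CompactSpace X := isCompact_iff_compactSpace.1 hXc.isCompact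
  have hn : (Y.subgroupOf X).Normal := (Subgroup.normal_subgroupOf_iff_le_normalizer hYX).2 hYn
  have hcl : IsClosed (Y.subgroupOf X : Set X) := hYc.preimage continuous_subtype_val
  obtain ⟨φ₁, hs₁, he₁, hk₁⟩ := h₁.exists_hom hYX hX hY hD₁ hD₁'
  obtain ⟨φ₂, hs₂, he₂, hk₂⟩ := h₂.exists_hom hYX hX hY hD₂ hD₂'
  exact ⟨X ⧸ Y.subgroupOf X, inferInstance, inferInstance, inferInstance, inferInstance,
    inferInstance, onSubquotient α Y X hY hX, φ₁, φ₂, hs₁, hs₂, he₁, he₂, hk₁, hk₂⟩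

end Covers

/-! ### Subnormal series as infinite sequences. -/

namespace SubnormalSeries

variable {G : Type u} [Group G] [TopologicalSpace G] {α : G ≃ₜ* G}

/-- The terms of a subnormal series, continued by `G`. -/
def seq (S : SubnormalSeries α) (i : ℕ) : Subgroup G :=
  S.term ⟨min i S.length, by lia⟩

theorem seq_coe (S : SubnormalSeries α) (i : Fin (S.length + 1)) : S.seq i = S.term i := by
  unfold seq
  congr
  lia

theorem seq_eq_top (S : SubnormalSeries α) {i : ℕ} (hi : S.length ≤ i) : S.seq i = ⊤ := by
  rw [← S.term_last, ← seq_coe]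
  simp [seq, hi]

end SubnormalSeries

/-! ### Schreier refinement and the butterfly. -/

section Schreier

variable {G : Type u} [Group G] [TopologicalSpace G] [IsTopologicalGroup G]

/-- An infinite ascending sequence, starting at the trivial group, of closed stable subgroups that
equal their nubs, each normal in the next one. -/
structure IsSubnormalSeq (α : G ≃ₜ* G) (a : ℕ → Subgroup G) : Prop where
  zero : a 0 = ⊥
  isClosed : ∀ i, IsClosed (a i : Set G)
  stable : ∀ i, Stable α (a i)
  nub_eq : ∀ i, nub α (a i) = a i
  le_succ : ∀ i, a i ≤ a (i + 1)
  le_normalizer : ∀ i, a (i + 1) ≤ Subgroup.normalizer (a i)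

variable (α : G ≃ₜ* G)

/-- The `j`th term inserted by the sequence `b` between `a i` and `a (i + 1)`. -/
def schreier (a b : ℕ → Subgroup G) (i j : ℕ) : Subgroup G :=
  nub α (a (i + 1) ⊓ b j) ⊔ a i

variable {α} {a b : ℕ → Subgroup G}

namespace IsSubnormalSeq

theorem nub_inf_le (ha : IsSubnormalSeq α a) (hb : IsSubnormalSeq α b) (i j : ℕ) :
    nub α (a i ⊓ b j) ≤ a i ⊓ b j :=
  nub_le ((ha.isClosed i).inter (hb.isClosed j))

theorem nub_inf_le_normalizer (ha : IsSubnormalSeq α a) (hb : IsSubnormalSeq α b) (i j : ℕ) :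
    nub α (a (i + 1) ⊓ b j) ≤ Subgroup.normalizer (a i) :=
  (ha.nub_inf_le hb _ _).trans (inf_le_left.trans (ha.le_normalizer i))

theorem nub_inf_succ_le_normalizer (hb : IsSubnormalSeq α b) (A : Subgroup G) (j : ℕ) :
    nub α (A ⊓ b (j + 1)) ≤ Subgroup.normalizer (nub α (A ⊓ b j)) :=
  nub_le_normalizer_nub ((inf_le_inf Subgroup.le_normalizer (hb.le_normalizer j)).trans
    Subgroup.inf_normalizer_le_normalizer_inf)

theorem mem_schreier (ha : IsSubnormalSeq α a) (hb : IsSubnormalSeq α b) {i j : ℕ} {x : G} :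
    x ∈ schreier α a b i j ↔ ∃ y ∈ nub α (a (i + 1) ⊓ b j), ∃ z ∈ a i, y * z = x := by
  rw [schreier, ← SetLike.mem_coe,
    Subgroup.coe_mul_of_left_le_normalizer_right _ _ (ha.nub_inf_le_normalizer hb i j)]
  rfl

theorem stable_schreier (ha : IsSubnormalSeq α a) (hb : IsSubnormalSeq α b) (i j : ℕ) :
    Stable α (schreier α a b i j) :=
  (stable_nub ((ha.stable _).inf (hb.stable _))).sup (ha.stable _)

theorem schreier_le_succ (i j : ℕ) (hb : IsSubnormalSeq α b) :
    schreier α a b i j ≤ schreier α a b i (j + 1) :=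
  sup_le_sup_right (nub_mono (inf_le_inf_left _ (hb.le_succ j))) _

theorem schreier_succ_le_normalizer (ha : IsSubnormalSeq α a) (hb : IsSubnormalSeq α b)
    (i j : ℕ) : schreier α a b i (j + 1) ≤ Subgroup.normalizer (schreier α a b i j) := by
  refine sup_le ?_ (le_sup_right.trans Subgroup.le_normalizer)
  exact (le_inf (hb.nub_inf_succ_le_normalizer (a (i + 1)) j)
    (ha.nub_inf_le_normalizer hb i (j + 1))).trans
    (Subgroup.normalizer_inf_normalizer_le_normalizer_sup _ _)

theorem schreier_top (ha : IsSubnormalSeq α a) {j : ℕ} (hj : b j = ⊤) (i : ℕ) :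
    schreier α a b i j = a (i + 1) := by
  rw [schreier, hj, inf_top_eq, ha.nub_eq, sup_eq_left.2 (ha.le_succ i)]

variable [T2Space G]

theorem schreier_zero (hb : IsSubnormalSeq α b) (i : ℕ) : schreier α a b i 0 = a i := by
  rw [schreier, hb.zero, inf_bot_eq, nub_bot, bot_sup_eq]

/-- Position `k` encodes the pair `(k / n, k % n)`. At the end of a block the carry is harmless: the
last term of one block is the first of the next, as `b n = ⊤` and `b 0 = ⊥`. -/
theorem schreier_div_mod_succ (ha : IsSubnormalSeq α a) (hb : IsSubnormalSeq α b) {n : ℕ}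
    (hn : 0 < n) (htop : b n = ⊤) (k : ℕ) :
    schreier α a b ((k + 1) / n) ((k + 1) % n) = schreier α a b (k / n) (k % n + 1) := by
  by_cases hk : n ∣ k + 1
  · have hmod : k % n + 1 = n := by
      have h1 := Nat.mod_lt k hn
      have h2 : (k % n + 1) % n = 0 := by
        rw [Nat.mod_add_mod]
        exact Nat.mod_eq_zero_of_dvd hk
      have h3 := Nat.le_of_dvd (Nat.succ_pos _) (Nat.dvd_of_mod_eq_zero h2)
      lia
    rw [Nat.succ_div_of_dvd hk, Nat.mod_eq_zero_of_dvd hk, hb.schreier_zero, hmod,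
      ha.schreier_top htop]
  · rw [Nat.succ_div_of_not_dvd hk]
    congr 1
    have h2 : (k % n + 1) % n ≠ 0 := by
      rw [Nat.mod_add_mod]
      exact fun h0 => hk (Nat.dvd_of_mod_eq_zero h0)
    have h1 : k % n + 1 < n :=
      lt_of_le_of_ne (Nat.mod_lt k hn) fun h0 => h2 (by rw [h0, Nat.mod_self])
    rw [← Nat.mod_eq_of_lt h1, Nat.mod_add_mod]

variable [CompactSpace G]

theorem isClosed_schreier (ha : IsSubnormalSeq α a) (hb : IsSubnormalSeq α b) (i j : ℕ) :
    IsClosed (schreier α a b i j : Set G) :=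
  isClosed_sup_of_le_normalizer isClosed_nub (ha.isClosed i) (ha.nub_inf_le_normalizer hb i j)

theorem nub_schreier (ha : IsSubnormalSeq α a) (hb : IsSubnormalSeq α b) (i j : ℕ) :
    nub α (schreier α a b i j) = schreier α a b i j :=
  nub_sup_eq nub_nub (ha.nub_eq i) (ha.isClosed_schreier hb i j)

/-- The finite-index form of the Zassenhaus butterfly. -/
theorem isFiniteCover (h : HasFiniteDepth α) (ha : IsSubnormalSeq α a) (hb : IsSubnormalSeq α b)
    (i j : ℕ) :
    IsFiniteCover (nub α (a (i + 1) ⊓ b (j + 1)))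
      (nub α (a (i + 1) ⊓ b j) ⊔ nub α (a i ⊓ b (j + 1)))
      (schreier α a b i (j + 1)) (schreier α a b i j) where
  le := le_sup_left
  le' := sup_le_sup_left ((ha.nub_inf_le hb _ _).trans inf_le_left) _
  exists_mul d hd := by
    obtain ⟨y, hy, z, hz, rfl⟩ := (ha.mem_schreier hb).1 hd
    exact ⟨y, hy, z, (le_sup_right : a i ≤ schreier α a b i j) hz, rfl⟩
  exists_finite := by
    -- The modular law leaves this factor of the kernel; `Y` contains the nub of `a i ⊓ b (j + 1)`,
    -- which has finite index there.
    refine ⟨a i ⊓ b (j + 1) ⊓ nub α (a (i + 1) ⊓ b (j + 1)), inf_le_right, fun h0 => ?_, ?_⟩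
    · exact relIndex_nub_ne_zero h ((ha.isClosed i).inter (hb.isClosed (j + 1)))
        ((ha.stable _).inf (hb.stable _))
        (Subgroup.relIndex_eq_zero_of_le_right inf_le_left
          (Subgroup.relIndex_eq_zero_of_le_left le_sup_right h0))
    · intro x hx hxD
      obtain ⟨y, hy, z, hz, rfl⟩ := (ha.mem_schreier hb).1 hxD
      have hyX : y ∈ nub α (a (i + 1) ⊓ b (j + 1)) :=
        nub_mono (inf_le_inf_left _ (hb.le_succ j)) hy
      have hzX : z ∈ nub α (a (i + 1) ⊓ b (j + 1)) := by
        simpa using mul_mem (inv_mem hyX) hx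
      exact ⟨y, Subgroup.mem_sup_left hy, z, ⟨⟨hz, (ha.nub_inf_le hb _ _ hzX).2⟩, hzX⟩, rfl⟩

/-- The covering quotient `X / Y` is unchanged when `(a, i)` and `(b, j)` are swapped, so
`isFiniteCover` applies to both sides. -/
theorem coCommensurable_schreier (h : HasFiniteDepth α) (ha : IsSubnormalSeq α a)
    (hb : IsSubnormalSeq α b) {i j : ℕ} {D₁ D₁' D₂ D₂' : Subgroup G}
    (e₁ : D₁ = schreier α a b i (j + 1)) (e₁' : D₁' = schreier α a b i j)
    (e₂ : D₂ = schreier α b a j (i + 1)) (e₂' : D₂' = schreier α b a j i)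
    (hD₁ : Stable α D₁) (hD₁' : Stable α D₁') (hD₂ : Stable α D₂) (hD₂' : Stable α D₂')
    [(D₁'.subgroupOf D₁).Normal] [(D₂'.subgroupOf D₂).Normal] :
    CoCommensurable (onSubquotient α D₁' D₁ hD₁' hD₁) (onSubquotient α D₂' D₂ hD₂' hD₂) := by
  have c₁ := isFiniteCover h ha hb i j
  have c₂ := isFiniteCover h hb ha j i
  rw [← e₁, ← e₁'] at c₁
  rw [← e₂, ← e₂', inf_comm (b (j + 1)) (a (i + 1)), inf_comm (b (j + 1)) (a i),
    inf_comm (b j) (a (i + 1)), sup_comm] at c₂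
  have hst : ∀ i j, Stable α (nub α (a i ⊓ b j)) := fun i j =>
    stable_nub ((ha.stable i).inf (hb.stable j))
  have hle₁ : nub α (a (i + 1) ⊓ b j) ≤ nub α (a (i + 1) ⊓ b (j + 1)) :=
    nub_mono (inf_le_inf_left _ (hb.le_succ j))
  have hle₂ : nub α (a i ⊓ b (j + 1)) ≤ nub α (a (i + 1) ⊓ b (j + 1)) :=
    nub_mono (inf_le_inf_right _ (ha.le_succ i))
  have hn₁ := hb.nub_inf_succ_le_normalizer (a (i + 1)) j
  have hn₂ := ha.nub_inf_succ_le_normalizer (b (j + 1)) i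
  rw [inf_comm (b (j + 1)) (a (i + 1)), inf_comm (b (j + 1)) (a i)] at hn₂
  exact c₁.coCommensurable c₂ (sup_le hle₁ hle₂)
    ((le_inf hn₁ hn₂).trans (Subgroup.normalizer_inf_normalizer_le_normalizer_sup _ _))
    isClosed_nub (isClosed_sup_of_le_normalizer isClosed_nub isClosed_nub (hle₁.trans hn₂))
    (hst _ _) ((hst _ _).sup (hst _ _)) hD₁ hD₁' hD₂ hD₂'

/-- The sequence obtained by inserting `n` terms in each step of `a` by means of `b`. -/
theorem refine (ha : IsSubnormalSeq α a) (hb : IsSubnormalSeq α b) {n : ℕ} (hn : 0 < n)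
    (htop : b n = ⊤) : IsSubnormalSeq α fun k => schreier α a b (k / n) (k % n) where
  zero := by simp [hb.schreier_zero, ha.zero]
  isClosed _ := ha.isClosed_schreier hb _ _
  stable _ := ha.stable_schreier hb _ _
  nub_eq _ := ha.nub_schreier hb _ _
  le_succ k := by
    rw [ha.schreier_div_mod_succ hb hn htop]
    exact schreier_le_succ _ _ hb
  le_normalizer k := by
    rw [ha.schreier_div_mod_succ hb hn htop]
    exact ha.schreier_succ_le_normalizer hb _ _

/-- The subnormal series formed by the terms up to `N` of a sequence that reaches `G` at `N`. -/
def toSeries (h : HasFiniteDepth α) (ha : IsSubnormalSeq α a) (N : ℕ) (htop : a N = ⊤) :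
    SubnormalSeries α where
  length := N
  term i := a i
  term_zero := ha.zero
  term_last := htop
  isClosed i := ha.isClosed i
  stable i := ha.stable i
  transitive i := (topTransitive_restrict_iff h (ha.isClosed i) (ha.stable i)).2 (ha.nub_eq i)
  le j := ha.le_succ j
  normal j := (Subgroup.normal_subgroupOf_iff_le_normalizer (ha.le_succ j)).2 (ha.le_normalizer j)
  transitive_quotient j :=
    haveI : ((a j).subgroupOf (a (j + 1))).Normal :=
      (Subgroup.normal_subgroupOf_iff_le_normalizer (ha.le_succ j)).2 (ha.le_normalizer j)
    ((topTransitive_restrict_iff h (ha.isClosed (j + 1)) (ha.stable (j + 1))).2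
      (ha.nub_eq (j + 1))).onSubquotient (ha.stable j)

end IsSubnormalSeq

namespace SubnormalSeries

variable [CompactSpace G] [T2Space G]

theorem isSubnormalSeq (h : HasFiniteDepth α) (S : SubnormalSeries α) : IsSubnormalSeq α S.seq where
  zero := by simpa [S.term_zero] using S.seq_coe 0
  isClosed i := S.isClosed _
  stable i := S.stable _
  nub_eq i := (topTransitive_restrict_iff h (S.isClosed _) (S.stable _)).1 (S.transitive _)
  le_succ i := by
    by_cases hi : i < S.length
    · have := S.le ⟨i, hi⟩
      rwa [← seq_coe, ← seq_coe] at this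
    · rw [S.seq_eq_top (i := i + 1) (by lia)]
      exact le_top
  le_normalizer i := by
    by_cases hi : i < S.length
    · have := (Subgroup.normal_subgroupOf_iff_le_normalizer (S.le ⟨i, hi⟩)).1 (S.normal ⟨i, hi⟩)
      rwa [← seq_coe, ← seq_coe] at this
    · rw [S.seq_eq_top (i := i) (by lia)]
      exact le_top.trans Subgroup.le_normalizer

/-- The refinement of `S` whose additional terms are inserted by means of `T`. -/
def schreierRefinement (h : HasFiniteDepth α) (S T : SubnormalSeries α) : SubnormalSeries α :=
  -- Block length `T.length + 1` is positive even when `T` has length 0; the sequence is still `⊤`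
  -- there.
  ((S.isSubnormalSeq h).refine (T.isSubnormalSeq h) (Nat.succ_pos T.length)
    (T.seq_eq_top (Nat.le_succ _))).toSeries h ((S.length + 1) * (T.length + 1)) (by
      rw [Nat.mul_div_left _ (Nat.succ_pos _), Nat.mul_mod_left,
        (T.isSubnormalSeq h).schreier_zero, S.seq_eq_top (Nat.le_succ _)])

theorem schreierRefinement_term (h : HasFiniteDepth α) (S T : SubnormalSeries α)
    (i : Fin ((S.length + 1) * (T.length + 1) + 1)) :
    (S.schreierRefinement h T).term i =
      schreier α S.seq T.seq (i / (T.length + 1)) (i % (T.length + 1)) :=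
  rfl

theorem schreierRefinement_isRefinement (h : HasFiniteDepth α) (S T : SubnormalSeries α) :
    (S.schreierRefinement h T).IsRefinement S := by
  refine ⟨fun i => ⟨i * (T.length + 1), Nat.lt_succ_of_le
    (Nat.mul_le_mul_right _ i.2.le)⟩, fun i j hij => ?_, fun i => ?_⟩
  · exact Nat.mul_lt_mul_of_pos_right hij (Nat.succ_pos _)
  · refine (S.schreierRefinement_term h T _).trans ?_
    simp only [Nat.mul_div_left _ (Nat.succ_pos T.length), Nat.mul_mod_left]
    rw [(T.isSubnormalSeq h).schreier_zero, seq_coe]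

theorem schreierRefinement_equivalent (h : HasFiniteDepth α) (S T : SubnormalSeries α) :
    (S.schreierRefinement h T).Equivalent (T.schreierRefinement h S) := by
  have hS := S.isSubnormalSeq h
  have hT := T.isSubnormalSeq h
  -- Transposition of the grid of pairs `(i, j)`.
  let π : Fin ((S.length + 1) * (T.length + 1)) ≃ Fin ((T.length + 1) * (S.length + 1)) :=
    finProdFinEquiv.symm.trans ((Equiv.prodComm _ _).trans finProdFinEquiv)
  have hπ : ∀ k, (π k : ℕ) = k / (T.length + 1) + (S.length + 1) * (k % (T.length + 1)) :=
    fun k => rfl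
  refine ⟨π, fun (k : Fin ((S.length + 1) * (T.length + 1))) => ?_⟩
  have hk : (k : ℕ) / (T.length + 1) < S.length + 1 :=
    Nat.div_lt_of_lt_mul (k.2.trans_eq (mul_comm _ _))
  have hdiv : (π k : ℕ) / (S.length + 1) = k % (T.length + 1) := by
    rw [hπ, Nat.add_mul_div_left _ _ (Nat.succ_pos _), Nat.div_eq_of_lt hk, zero_add]
  have hmod : (π k : ℕ) % (S.length + 1) = k / (T.length + 1) := by
    rw [hπ, Nat.add_mul_mod_self_left, Nat.mod_eq_of_lt hk]
  have := (S.schreierRefinement h T).normal k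
  have := (T.schreierRefinement h S).normal (π k)
  refine hS.coCommensurable_schreier h hT (i := k / (T.length + 1)) (j := k % (T.length + 1))
    ?_ ?_ ?_ ?_ _ _ _ _
  · exact hS.schreier_div_mod_succ hT (Nat.succ_pos _) (T.seq_eq_top (Nat.le_succ _)) k
  · rfl
  · refine (hT.schreier_div_mod_succ hS (Nat.succ_pos _) (S.seq_eq_top (Nat.le_succ _))
      (π k)).trans ?_
    rw [hdiv, hmod]
  · refine (T.schreierRefinement_term h S _).trans ?_
    exact congrArg₂ _ hdiv hmod

end SubnormalSeries

end Schreier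

end FiniteDepth

theorem theorem6p15 {G : Type*} [Group G] [TopologicalSpace G] [IsTopologicalGroup G]
    [CompactSpace G] [T2Space G] (α : G ≃ₜ* G)
    (htrans : FiniteDepth.TopTransitive α) (hdepth : FiniteDepth.HasFiniteDepth α)
    (S T : FiniteDepth.SubnormalSeries α) :
    ∃ S' T' : FiniteDepth.SubnormalSeries α,
      S'.IsRefinement S ∧ T'.IsRefinement T ∧ S'.Equivalent T' :=
  ⟨S.schreierRefinement hdepth T, T.schreierRefinement hdepth S,
    S.schreierRefinement_isRefinement hdepth T, T.schreierRefinement_isRefinement hdepth S,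
    S.schreierRefinement_equivalent hdepth T⟩
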